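/- Let $(X,\|\cdot\|)$ be a real Banach space with topological dual $X^*$, and suppose that $X$ is Gâteaux smooth, i.e. its norm is Gâteaux differentiable on $X\setminus\{0\}$. For a set-valued mapping $T:X\rightrightarrows X^*$ put $\operatorname{dom}T=\{x: T(x)\neq\emptyset\}$ and $\operatorname{gph}T=\{(x,x^*): x^*\in T(x)\}$. Let $J(x)=\{x^*\in X^*:\ \langle x^*,x\rangle=\|x\|^2=\|x^*\|^2\}$ be the duality mapping. The operator $T$ is *monotone* if $\langle x_1^*-x_2^*,x_1-x_2\rangle\ge 0$ for all $(x_1,x_1^*),(x_2,x_2^*)\in\operatorname{gph}T$, and *maximal monotone* if it is monotone and $\operatorname{gph}T=\operatorname{gph}S$ for every monotone $S:X\rightrightarrows X^*$ with $\operatorname{gph}T\subset\operatorname{gph}S$. For $\sigma>0$, $T$ is *$\sigma$-strongly monotone* if $T-\sigma J$ is monotone, and *$\sigma$-strongly maximal monotone* if it is $\sigma$-strongly monotone and maximal monotone (i.e. maximal among all monotone operators). Let $\sigma>0$ and let $T:X\rightrightarrows X^*$ be $\sigma$-strongly monotone. Assume that either $X$ is reflexive, or the set $\operatorname{dom}T$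 is closed and convex. Then $T$ is $\sigma$-strongly maximal monotone if and only if $$\operatorname{gph}T=\operatorname{gph}S\quad\text{for every $\sigma$-strongly monotone } S:X\rightrightarrows X^*\text{ with }\operatorname{gph}T\subset\operatorname{gph}S .$$ -/

import Mathlib

namespace MonotoneOperators

open scoped Pointwise

/-- Graph of a set-valued mapping. -/
def gph {X Y : Type*} (F : X → Set Y) : Set (X × Y) :=
  {p | p.2 ∈ F p.1}

/-- Domain of a set-valued mapping. -/
def dom {X Y : Type*} (F : X → Set Y) : Set X :=
  {x | (F x).Nonempty}

/-- A real normed space is Gâteaux smooth if its norm is Gâteaux differentiable (with a bounded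
linear Gâteaux derivative) at every nonzero point. -/
def GateauxSmooth (X : Type*) [NormedAddCommGroup X] [NormedSpace ℝ X] : Prop :=
  ∀ x : X, x ≠ 0 → ∃ D : StrongDual ℝ X, ∀ v : X,
    HasLineDerivAt ℝ (fun y : X => ‖y‖) (D v) x v

/-- Reflexivity: the canonical embedding into the bidual is onto. -/
def Reflexive (X : Type*) [NormedAddCommGroup X] [NormedSpace ℝ X] : Prop :=
  Function.Surjective (NormedSpace.inclusionInDoubleDual ℝ X)

variable {X : Type*} [NormedAddCommGroup X] [NormedSpace ℝ X]

/-- The (normalized) duality mapping `J : X ⇉ X*`. -/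
def dualityMap (x : X) : Set (StrongDual ℝ X) :=
  {f | f x = ‖x‖ ^ 2 ∧ ‖f‖ ^ 2 = ‖x‖ ^ 2}

/-- Monotone set-valued operators `T : X ⇉ X*`. -/
def IsMonotone (T : X → Set (StrongDual ℝ X)) : Prop :=
  ∀ p ∈ gph T, ∀ q ∈ gph T, 0 ≤ (p.2 - q.2) (p.1 - q.1)

/-- Maximal monotone operators: monotone, and without a proper monotone extension. -/
def IsMaximalMonotone (T : X → Set (StrongDual ℝ X)) : Prop :=
  IsMonotone T ∧
    ∀ S : X → Set (StrongDual ℝ X), IsMonotone S → gph T ⊆ gph S → gph T = gph S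

/-- `T` is `σ`-strongly monotone if `T - σ J` is monotone. -/
def IsStronglyMonotone (σ : ℝ) (T : X → Set (StrongDual ℝ X)) : Prop :=
  IsMonotone (fun x => T x - σ • dualityMap x)

/-- `T` is `σ`-strongly maximal monotone if it is `σ`-strongly monotone and maximal among
all monotone operators. -/
def IsStronglyMaximalMonotone (σ : ℝ) (T : X → Set (StrongDual ℝ X)) : Prop :=
  IsStronglyMonotone σ T ∧ IsMaximalMonotone T

/-- Strong monotonicity written out as an inequality. -/
theorem isStronglyMonotone_iff (σ : ℝ) (T : X → Set (StrongDual ℝ X)) :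
    IsStronglyMonotone σ T ↔
      ∀ x₁ x₂ : X, ∀ f₁ ∈ T x₁, ∀ f₂ ∈ T x₂, ∀ j₁ ∈ dualityMap x₁, ∀ j₂ ∈ dualityMap x₂,
        σ * (j₁ - j₂) (x₁ - x₂) ≤ (f₁ - f₂) (x₁ - x₂) := by
  constructor
  · intro h x₁ x₂ f₁ hf₁ f₂ hf₂ j₁ hj₁ j₂ hj₂
    have := h (x₁, f₁ - σ • j₁) (Set.sub_mem_sub hf₁ (Set.smul_mem_smul_set hj₁))
      (x₂, f₂ - σ • j₂) (Set.sub_mem_sub hf₂ (Set.smul_mem_smul_set hj₂))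
    simp only [sub_apply, smul_apply, smul_eq_mul] at this ⊢
    linarith
  · rintro h ⟨x₁, _⟩ ⟨f₁, hf₁, _, ⟨j₁, hj₁, rfl⟩, rfl⟩ ⟨x₂, _⟩ ⟨f₂, hf₂, _, ⟨j₂, hj₂, rfl⟩, rfl⟩
    have := h x₁ x₂ f₁ hf₁ f₂ hf₂ j₁ hj₁ j₂ hj₂
    simp only [sub_apply, smul_apply, smul_eq_mul] at this ⊢
    linarith

end MonotoneOperators

/-!
The duality mapping `J` is the subdifferential of `‖·‖² / 2`, so it is single-valued in a Gâteaux
smooth space. Hence `S ↦ S - σJ` and `A ↦ A + σJ` are mutually inverse and preserve inclusions of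
graphs, and `T` is maximal among the `σ`-strongly monotone operators exactly if `A = T - σJ` is
maximal monotone. What remains is a sum theorem: if `A` is maximal monotone, then so is `A + ∂θ`
with `θ = σ‖·‖² / 2`.

In a reflexive space, a pair `(x, f)` monotonically related to `A + ∂θ` is compared with a solution
`z` of `f ∈ A z + ∂(θ + ‖· - x‖² / 2) z`, which Fitzpatrick's function and a separation argument
provide; monotonicity then gives `z = x`.

If `dom A` is closed and convex and `x ∉ dom A`, the Bishop–Phelps theorem gives `y ∈ dom A` at
which `A y` contains a ray along a functional that is larger at `x` than at `y`, so `(x, f)` is not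
monotonically related to `A + ∂θ`. If `x ∈ dom A`, comparison along the segments from `x` to points
of `dom A` and Gâteaux differentiability of `θ` at `x` show that `f - ∂θ(x)` is monotonically
related to `A` at `x`.
-/

namespace MonotoneOperators

open Filter Function Set Topology
open scoped Pointwise

section ConvexAnalysis

section

variable {E : Type*} [AddCommGroup E] [Module ℝ E] [TopologicalSpace E]

/-- The convex subdifferential of a real-valued function, whose elements are its continuous
subgradients. -/
def subdifferential (θ : E → ℝ) (x : E) : Set (StrongDual ℝ E) :=
  {f | ∀ y, θ x + f (y - x) ≤ θ y}

theorem subdifferential_const_mul {c : ℝ} (hc : 0 < c) (θ : E → ℝ) (x : E) :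
    subdifferential (fun y => c * θ y) x = c • subdifferential θ x := by
  ext f
  rw [mem_smul_set_iff_inv_smul_mem₀ hc.ne']
  refine forall_congr' fun y => ?_
  rw [smul_apply, smul_eq_mul, ← mul_le_mul_iff_right₀ hc (b := θ x + _), mul_add,
    mul_inv_cancel_left₀ hc.ne']

theorem subdifferential_comp_sub_right (θ : E → ℝ) (a x : E) :
    subdifferential (fun y => θ (y - a)) x = subdifferential θ (x - a) := by
  ext f
  refine ⟨fun hf y => ?_, fun hf y => ?_⟩
  · simpa [add_sub_cancel_right, sub_sub_eq_add_sub] using hf (y + a)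
  · simpa only [sub_sub_sub_cancel_right] using hf (y - a)

theorem hasLineDerivAt_of_mem_subdifferential {θ : E → ℝ} {x v : E} {f : StrongDual ℝ E}
    (hf : f ∈ subdifferential θ x) (hθ : LineDifferentiableAt ℝ θ x v) :
    HasLineDerivAt ℝ θ (f v) x v := by
  have hderiv : HasDerivAt (fun t : ℝ => θ (x + t • v) - t * f v)
      (lineDeriv ℝ θ x v - 1 * f v) 0 :=
    HasDerivAt.sub hθ.hasLineDerivAt ((hasDerivAt_id (0 : ℝ)).mul_const (f v))
  have hmin : IsLocalMin (fun t : ℝ => θ (x + t • v) - t * f v) 0 := by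
    refine Eventually.of_forall fun t => ?_
    have hsub := hf (x + t • v)
    simp only [add_sub_cancel_left, map_smul, smul_eq_mul] at hsub
    simp only [zero_smul, add_zero, zero_mul, sub_zero]
    linarith
  have hzero := hmin.hasDerivAt_eq_zero hderiv
  rw [one_mul, sub_eq_zero] at hzero
  exact hzero ▸ hθ.hasLineDerivAt

theorem subdifferential_subsingleton {θ : E → ℝ} {x : E}
    (hθ : ∀ v, LineDifferentiableAt ℝ θ x v) : (subdifferential θ x).Subsingleton :=
  fun _ hf _ hg => ContinuousLinearMap.ext fun v =>
    (hasLineDerivAt_of_mem_subdifferential hf (hθ v)).unique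
      (hasLineDerivAt_of_mem_subdifferential hg (hθ v))

end

section Separation

variable {E : Type*} [AddCommGroup E] [Module ℝ E] [TopologicalSpace E]
  [IsTopologicalAddGroup E] [ContinuousSMul ℝ E]

theorem exists_affine_between_concave_and_convex {p : E → ℝ} (hp : ConcaveOn ℝ univ p)
    (hp_cont : Continuous p) {K : Set (E × ℝ)} (hK : Convex ℝ K) (hK_ne : K.Nonempty)
    (hpK : ∀ q ∈ K, p q.1 ≤ q.2) :
    ∃ (f : StrongDual ℝ E) (c : ℝ), (∀ x, p x ≤ f x + c) ∧ ∀ q ∈ K, f q.1 + c ≤ q.2 := by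
  have hopen : IsOpen {q : E × ℝ | q.1 ∈ univ ∧ q.2 < p q.1} := by
    simpa only [mem_univ, true_and] using
      isOpen_lt continuous_snd (by fun_prop : Continuous fun q : E × ℝ => p q.1)
  have hdisj : Disjoint {q : E × ℝ | q.1 ∈ univ ∧ q.2 < p q.1} K :=
    disjoint_left.2 fun q hq hqK => (hpK q hqK).not_gt hq.2
  obtain ⟨F, u, hF_lt, hF_ge⟩ :=
    geometric_hahn_banach_open hp.convex_strict_hypograph hopen hK hdisj
  set κ : ℝ := F (0, 1) with hκ_def
  set g : StrongDual ℝ E := F.comp (ContinuousLinearMap.inl ℝ E ℝ)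
  have hF : ∀ x r, F (x, r) = g x + r * κ := fun x r => by
    rw [hκ_def, ← smul_eq_mul, ← map_smul]
    simp [g, ← map_add]
  have hlow : ∀ q ∈ K, u ≤ g q.1 + q.2 * κ := fun q hq => (hF_ge q hq).trans_eq (hF q.1 q.2)
  have hupp : ∀ x r, r < p x → g x + r * κ < u := fun x r hr =>
    (hF x r).symm.trans_lt (hF_lt (x, r) ⟨mem_univ x, hr⟩)
  have hκ : 0 < κ := by
    obtain ⟨q, hq⟩ := hK_ne
    have h := (hupp q.1 (p q.1 - 1) (sub_one_lt _)).trans_le (hlow q hq)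
    have h' := hpK q hq
    by_contra! hneg
    nlinarith
  refine ⟨-(κ⁻¹ • g), κ⁻¹ * u, fun x => ?_, fun q hq => ?_⟩ <;>
    simp only [neg_apply, smul_apply, smul_eq_mul]
  · refine le_of_forall_lt_imp_le_of_dense fun r hr => ?_
    rw [neg_add_eq_sub, ← mul_sub, le_inv_mul_iff₀ hκ]
    linarith [hupp x r hr]
  · rw [neg_add_eq_sub, ← mul_sub, inv_mul_le_iff₀ hκ]
    linarith [hlow q hq]

theorem subdifferential_nonempty {θ : E → ℝ} (hθ : ConvexOn ℝ univ θ) (hθ_cont : Continuous θ)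
    (x : E) : (subdifferential θ x).Nonempty := by
  obtain ⟨f, c, hupp, hlow⟩ := exists_affine_between_concave_and_convex hθ.neg hθ_cont.neg
    (convex_singleton (x, -θ x)) (singleton_nonempty _) (by rintro _ rfl; rfl)
  refine ⟨-f, fun y => ?_⟩
  have hx := hlow _ rfl
  have hy := hupp y
  simp only [Pi.neg_apply, neg_apply, map_sub] at hx hy ⊢
  linarith

theorem exists_add_eq_of_mem_subdifferential_add {φ ψ : E → ℝ} (hφ : ConvexOn ℝ univ φ)
    (hψ : ConvexOn ℝ univ ψ) (hψ_cont : Continuous ψ) {x : E} {f : StrongDual ℝ E}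
    (hf : f ∈ subdifferential (fun y => φ y + ψ y) x) :
    ∃ g ∈ subdifferential φ x, ∃ h ∈ subdifferential ψ x, g + h = f := by
  obtain ⟨g, c, hupp, hlow⟩ := exists_affine_between_concave_and_convex
    (p := fun y => (f y + (φ x + ψ x - f x)) - ψ y)
    (((f.toLinearMap.concaveOn convex_univ).add_const _).sub hψ) (by fun_prop)
    hφ.convex_epigraph ⟨(x, φ x), mem_univ x, le_rfl⟩ fun q hq => by
      have hsub := hf q.1
      rw [map_sub] at hsub
      linarith [hq.2]
  have hgx : g x + c ≤ φ x := hlow (x, φ x) ⟨mem_univ x, le_rfl⟩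
  refine ⟨g, fun y => ?_, f - g, fun y => ?_, add_sub_cancel g f⟩
  · have hgy : g y + c ≤ φ y := hlow (y, φ y) ⟨mem_univ y, le_rfl⟩
    rw [map_sub]
    linarith [hupp x]
  · simp only [sub_apply, map_sub]
    linarith [hupp y]

end Separation

section Conjugate

theorem continuous_of_lowerSemicontinuous_of_convexOn {E : Type*} [NormedAddCommGroup E]
    [NormedSpace ℝ E] [BaireSpace E] {φ : E → ℝ} (hφ : ConvexOn ℝ univ φ)
    (hφ_lsc : LowerSemicontinuous φ) : Continuous φ := by
  obtain ⟨n, x, hx⟩ := nonempty_interior_of_iUnion_of_closed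
    (f := fun n : ℕ => φ ⁻¹' Iic (n : ℝ)) (fun n => hφ_lsc.isClosed_preimage n)
    (eq_univ_of_forall fun x => mem_iUnion.2 (exists_nat_ge (φ x)))
  have hbdd : ∃ x ∈ (univ : Set E), (𝓝 x).IsBoundedUnder (· ≤ ·) φ :=
    ⟨x, mem_univ x, n, eventually_map.2 (mem_interior_iff_mem_nhds.1 hx)⟩
  rw [← continuousOn_univ]
  exact ((hφ.continuousOn_tfae isOpen_univ univ_nonempty).out 3 1).1 hbdd

variable {X : Type*} [NormedAddCommGroup X] [NormedSpace ℝ X]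

/-- A function is cofinite if its Fenchel conjugate is finite everywhere. -/
def IsCofinite (φ : X → ℝ) : Prop :=
  ∀ g : StrongDual ℝ X, BddAbove (range fun x => g x - φ x)

/-- The Fenchel conjugate, as a real-valued function; its value is meaningful at `g` only if
`g - φ` is bounded above, and everywhere if `φ` is cofinite. -/
noncomputable def conjugate (φ : X → ℝ) (g : StrongDual ℝ X) : ℝ :=
  ⨆ x, (g x - φ x)

theorem IsCofinite.apply_sub_le_conjugate {φ : X → ℝ} (hφ : IsCofinite φ) (g : StrongDual ℝ X)
    (x : X) : g x - φ x ≤ conjugate φ g :=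
  le_ciSup (hφ g) x

theorem conjugate_le_of_mem_subdifferential {φ : X → ℝ} {x : X} {g : StrongDual ℝ X}
    (hg : g ∈ subdifferential φ x) : conjugate φ g ≤ g x - φ x :=
  ciSup_le fun y => by
    have hsub := hg y
    rw [map_sub] at hsub
    linarith

theorem IsCofinite.convexOn_conjugate {φ : X → ℝ} (hφ : IsCofinite φ) :
    ConvexOn ℝ univ (conjugate φ) := by
  refine ⟨convex_univ, fun g _ h _ a b ha hb hab => ciSup_le fun x => ?_⟩
  calc (a • g + b • h) x - φ x = a * (g x - φ x) + b * (h x - φ x) := by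
        obtain rfl : b = 1 - a := by linarith
        simp only [add_apply, smul_apply, smul_eq_mul]
        ring
    _ ≤ a * conjugate φ g + b * conjugate φ h := by
        gcongr <;> exact hφ.apply_sub_le_conjugate _ x

theorem IsCofinite.continuous_conjugate {φ : X → ℝ} (hφ : IsCofinite φ) :
    Continuous (conjugate φ) :=
  continuous_of_lowerSemicontinuous_of_convexOn hφ.convexOn_conjugate <|
    lowerSemicontinuous_ciSup hφ fun x =>
      Continuous.lowerSemicontinuous (f := fun g : StrongDual ℝ X => g x - φ x) (by fun_prop)

end Conjugate

end ConvexAnalysis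

section DualityMap

variable {X : Type*} [NormedAddCommGroup X] [NormedSpace ℝ X]

theorem apply_le_half_sq_norm_add (f : StrongDual ℝ X) (x : X) :
    f x ≤ ‖f‖ ^ 2 / 2 + ‖x‖ ^ 2 / 2 := by
  have hfx : f x ≤ ‖f‖ * ‖x‖ := (le_abs_self _).trans (f.le_opNorm x)
  linarith [two_mul_le_add_sq ‖f‖ ‖x‖]

theorem convexOn_half_sq_norm : ConvexOn ℝ univ (fun x : X => ‖x‖ ^ 2 / 2) := by
  simpa [div_eq_inv_mul] using
    (convexOn_univ_norm.pow (fun _ _ => norm_nonneg _) 2).smul (c := (2⁻¹ : ℝ)) (by norm_num)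

theorem mem_dualityMap_of_mem_subdifferential {x : X} {f : StrongDual ℝ X}
    (hf : f ∈ subdifferential (fun y : X => ‖y‖ ^ 2 / 2) x) : f ∈ dualityMap x := by
  have hfx : f x = ‖x‖ ^ 2 := by
    have hdiscr := discrim_le_zero (a := ‖x‖ ^ 2 / 2) (b := ‖x‖ ^ 2 - f x) (c := 0) fun t => by
      have h : ‖x‖ ^ 2 / 2 + f ((1 + t) • x - x) ≤ ‖(1 + t) • x‖ ^ 2 / 2 := hf _
      rw [show (1 + t) • x - x = t • x by module, map_smul, norm_smul, mul_pow,
        Real.norm_eq_abs, sq_abs, smul_eq_mul] at h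
      linarith
    have hsq : (‖x‖ ^ 2 - f x) ^ 2 ≤ 0 := by simpa [discrim] using hdiscr
    linarith [pow_eq_zero_iff two_ne_zero |>.1 (hsq.antisymm (sq_nonneg _))]
  have hle : ‖f‖ ≤ ‖x‖ := f.opNorm_le_bound (norm_nonneg x) fun v => by
    have hdiscr := discrim_le_zero (a := ‖v‖ ^ 2 / 2) (b := -f v) (c := ‖x‖ ^ 2 / 2) fun t => by
      have h : ‖x‖ ^ 2 / 2 + f (t • v - x) ≤ ‖t • v‖ ^ 2 / 2 := hf _
      rw [map_sub, hfx, map_smul, norm_smul, mul_pow, Real.norm_eq_abs, sq_abs,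
        smul_eq_mul] at h
      linarith
    refine abs_le_of_sq_le_sq ?_ (by positivity)
    rw [discrim] at hdiscr
    linarith
  have hge : ‖x‖ ^ 2 ≤ ‖f‖ * ‖x‖ := hfx ▸ (le_abs_self _).trans (f.le_opNorm x)
  exact ⟨hfx, by nlinarith [norm_nonneg f]⟩

theorem subdifferential_half_sq_norm (x : X) :
    subdifferential (fun y : X => ‖y‖ ^ 2 / 2) x = dualityMap x := by
  refine Subset.antisymm (fun _ => mem_dualityMap_of_mem_subdifferential) fun f hf y => ?_
  rw [map_sub, hf.1]
  linarith [apply_le_half_sq_norm_add f y, hf.2]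

theorem subdifferential_mul_half_sq_norm {σ : ℝ} (hσ : 0 < σ) (x : X) :
    subdifferential (fun y : X => σ * (‖y‖ ^ 2 / 2)) x = σ • dualityMap x := by
  rw [subdifferential_const_mul hσ, subdifferential_half_sq_norm]

theorem dualityMap_nonempty (x : X) : (dualityMap x).Nonempty :=
  subdifferential_half_sq_norm x ▸
    subdifferential_nonempty convexOn_half_sq_norm (by fun_prop) x

theorem GateauxSmooth.lineDifferentiableAt_half_sq_norm (hX : GateauxSmooth X) (x v : X) :
    LineDifferentiableAt ℝ (fun y : X => ‖y‖ ^ 2 / 2) x v := by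
  by_cases hx : x = 0
  · have hquad : (fun t : ℝ => ‖x + t • v‖ ^ 2 / 2) = fun t => t ^ 2 * (‖v‖ ^ 2 / 2) := by
      ext t
      rw [hx, zero_add, norm_smul, mul_pow, Real.norm_eq_abs, sq_abs, mul_div_assoc]
    rw [LineDifferentiableAt, hquad]
    fun_prop
  · obtain ⟨D, hD⟩ := hX x hx
    exact (((hD v).pow 2).div_const 2).differentiableAt

theorem GateauxSmooth.exists_dualityMap_eq_singleton (hX : GateauxSmooth X) (x : X) :
    ∃ j, dualityMap x = {j} := by
  have hsub : (dualityMap x).Subsingleton := subdifferential_half_sq_norm x ▸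
    subdifferential_subsingleton (hX.lineDifferentiableAt_half_sq_norm x)
  exact exists_eq_singleton_iff_nonempty_subsingleton.2 ⟨dualityMap_nonempty x, hsub⟩

theorem isCofinite_add_half_sq_dist {θ : X → ℝ} (hθ : ConvexOn ℝ univ θ)
    (hθ_cont : Continuous θ) (a : X) : IsCofinite fun x => θ x + ‖x - a‖ ^ 2 / 2 := by
  intro g
  obtain ⟨s, hs⟩ := subdifferential_nonempty hθ hθ_cont a
  refine ⟨g a - θ a + ‖g - s‖ ^ 2 / 2, ?_⟩
  rintro _ ⟨x, rfl⟩
  have hsx := hs x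
  have hyoung := apply_le_half_sq_norm_add (g - s) (x - a)
  simp only [sub_apply, map_sub] at hsx hyoung ⊢
  linarith

end DualityMap

section SupportPoints

section Ekeland

variable {M : Type*} [PseudoMetricSpace M]

/-- The points that a descent from `y` with slope at least `ε` can reach; these are the lower sets
of the order on which Ekeland's variational principle rests. -/
def descentSet (φ : M → ℝ) (ε : ℝ) (y : M) : Set M :=
  {z | φ z + ε * dist z y ≤ φ y}

theorem self_mem_descentSet (φ : M → ℝ) (ε : ℝ) (y : M) : y ∈ descentSet φ ε y := by
  simp [descentSet]

theorem isClosed_descentSet {φ : M → ℝ} (hφ : LowerSemicontinuous φ) (ε : ℝ) (y : M) :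
    IsClosed (descentSet φ ε y) :=
  (hφ.add (Continuous.lowerSemicontinuous (by fun_prop))).isClosed_preimage (φ y)

theorem descentSet_subset_descentSet {φ : M → ℝ} {ε : ℝ} (hε : 0 ≤ ε) {y z : M}
    (hz : z ∈ descentSet φ ε y) : descentSet φ ε z ⊆ descentSet φ ε y := by
  intro w (hw : φ w + ε * dist w z ≤ φ z)
  change φ z + ε * dist z y ≤ φ y at hz
  change φ w + ε * dist w y ≤ φ y
  linarith [mul_le_mul_of_nonneg_left (dist_triangle w z y) hε]

theorem exists_mem_descentSet_subset_closedBall {φ : M → ℝ} (hφ : BddBelow (range φ)) {ε : ℝ}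
    (hε : 0 < ε) (y : M) {δ : ℝ} (hδ : 0 < δ) :
    ∃ z ∈ descentSet φ ε y, descentSet φ ε z ⊆ Metric.closedBall z δ := by
  have hbdd : BddBelow (φ '' descentSet φ ε y) := hφ.mono (image_subset_range _ _)
  obtain ⟨_, ⟨z, hz, rfl⟩, hz_lt⟩ := exists_lt_of_csInf_lt
    (Set.Nonempty.image φ ⟨y, self_mem_descentSet φ ε y⟩)
    (lt_add_of_pos_right (sInf (φ '' descentSet φ ε y)) (mul_pos hε hδ))
  refine ⟨z, hz, fun w hw => le_of_mul_le_mul_left (a := ε) ?_ hε⟩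
  have hinf := csInf_le hbdd (mem_image_of_mem φ (descentSet_subset_descentSet hε.le hz hw))
  change φ w + ε * dist w z ≤ φ z at hw
  linarith

/-- **Ekeland's variational principle**. -/
theorem exists_forall_ne_lt_add_dist {M : Type*} [MetricSpace M] [CompleteSpace M] [Nonempty M]
    {φ : M → ℝ} (hφ : LowerSemicontinuous φ) (hφ_bdd : BddBelow (range φ)) {ε : ℝ} (hε : 0 < ε) :
    ∃ y, ∀ z ≠ y, φ y < φ z + ε * dist z y := by
  choose next hnext_mem hnext_ball using fun (y : M) (n : ℕ) =>
    exists_mem_descentSet_subset_closedBall hφ_bdd hε y (δ := (1 / 2) ^ n) (by positivity)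
  obtain ⟨y₀⟩ := ‹Nonempty M›
  let u : ℕ → M := fun n => n.rec y₀ fun k y => next y k
  let s : ℕ → Set M := fun n => descentSet φ ε (u (n + 1))
  have hs_ball : ∀ n, s n ⊆ Metric.closedBall (u (n + 1)) ((1 / 2) ^ n) :=
    fun n => hnext_ball (u n) n
  have hs_anti : Antitone s := antitone_nat_of_succ_le fun n =>
    descentSet_subset_descentSet hε.le (hnext_mem (u (n + 1)) (n + 1))
  have hs_bdd : ∀ n, Bornology.IsBounded (s n) :=
    fun n => Metric.isBounded_closedBall.subset (hs_ball n)
  have hs_diam : Tendsto (fun n => Metric.diam (s n)) atTop (𝓝 0) := by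
    refine squeeze_zero (fun _ => Metric.diam_nonneg) (g := fun n : ℕ => 2 * (1 / 2 : ℝ) ^ n)
      (fun n => ?_) ?_
    · exact (Metric.diam_mono (hs_ball n) Metric.isBounded_closedBall).trans
        (Metric.diam_closedBall (by positivity))
    · simpa using (tendsto_pow_atTop_nhds_zero_of_lt_one (r := (1 / 2 : ℝ))
        (by norm_num) (by norm_num)).const_mul 2
  obtain ⟨y, hy⟩ := Metric.nonempty_iInter_of_nonempty_biInter
    (fun n => isClosed_descentSet hφ ε (u (n + 1))) hs_bdd
    (fun N => ⟨u (N + 1), mem_iInter₂.2 fun _ hn => hs_anti hn (self_mem_descentSet φ ε _)⟩)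
    hs_diam
  rw [mem_iInter] at hy
  refine ⟨y, fun z hzy => not_le.1 fun hz => hzy ?_⟩
  have hz_mem : ∀ n, z ∈ s n := fun n => descentSet_subset_descentSet hε.le (hy n) hz
  exact dist_le_zero.1 <| ge_of_tendsto' hs_diam fun n =>
    Metric.dist_le_diam_of_mem (hs_bdd n) (hz_mem n) (hy n)

end Ekeland

/-- A form of the **Bishop–Phelps theorem**. Ekeland's principle for the distance to `x₀` yields
a point `y` and a concave function that vanishes at `y`, is nonpositive on `D` and positive at
`x₀`; then `n` separates this function from `D`. -/
theorem exists_support_functional_lt {X : Type*} [NormedAddCommGroup X] [NormedSpace ℝ X]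
    {D : Set X} (hD : IsComplete D) (hD_conv : Convex ℝ D) (hD_ne : D.Nonempty) {x₀ : X}
    (hx₀ : x₀ ∉ D) :
    ∃ y ∈ D, ∃ n : StrongDual ℝ X, (∀ z ∈ D, n z ≤ n y) ∧ n y < n x₀ := by
  have : CompleteSpace D := completeSpace_coe_iff_isComplete.2 hD
  have : Nonempty D := hD_ne.to_subtype
  obtain ⟨⟨y, hy⟩, hmin⟩ := exists_forall_ne_lt_add_dist (φ := fun z : D => dist (z : X) x₀)
    (Continuous.lowerSemicontinuous (by fun_prop))
    ⟨0, forall_mem_range.2 fun _ => dist_nonneg⟩ (one_half_pos (α := ℝ))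
  have hle : ∀ z ∈ D, dist y x₀ - (dist z x₀ + 1 / 2 * dist z y) ≤ 0 := by
    intro z hz
    rcases eq_or_ne z y with rfl | hzy
    · simp
    · exact sub_nonpos.2 (hmin ⟨z, hz⟩ (by simpa using hzy)).le
  have hconc : ConcaveOn ℝ univ fun z => dist y x₀ - (dist z x₀ + 1 / 2 * dist z y) :=
    (concaveOn_const _ convex_univ).sub ((convexOn_univ_dist x₀).add
      ((convexOn_univ_dist y).smul (one_half_pos (α := ℝ)).le))
  obtain ⟨n, c, hupp, hlow⟩ := exists_affine_between_concave_and_convex hconc (by fun_prop)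
    (hD_conv.prod (convex_Ici (0 : ℝ))) (hD_ne.prod nonempty_Ici)
    fun q hq => (hle q.1 hq.1).trans hq.2
  have hn_le : ∀ z ∈ D, n z + c ≤ 0 := fun z hz => hlow (z, 0) ⟨hz, self_mem_Ici⟩
  have hny : 0 ≤ n y + c := by simpa using hupp y
  have hnx₀ : 0 < n x₀ + c := by
    have hpos : 0 < dist y x₀ := dist_pos.2 fun h => hx₀ (h ▸ hy)
    have h := hupp x₀
    rw [dist_self, dist_comm x₀ y] at h
    linarith
  exact ⟨y, hy, n, fun z hz => by linarith [hn_le z hz], by linarith [hn_le y hy]⟩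

end SupportPoints

section MaximalMonotone

variable {X : Type*} [NormedAddCommGroup X] [NormedSpace ℝ X] {A B : X → Set (StrongDual ℝ X)}

theorem gph_subset_gph_iff {Y Z : Type*} {F G : Y → Set Z} :
    gph F ⊆ gph G ↔ ∀ x, F x ⊆ G x :=
  ⟨fun h x f hf => h (show (x, f) ∈ gph F from hf), fun h p hp => h p.1 hp⟩

theorem gph_injective {Y Z : Type*} : Injective (gph : (Y → Set Z) → Set (Y × Z)) :=
  fun _ _ h => funext fun x => (gph_subset_gph_iff.1 h.subset x).antisymm
    (gph_subset_gph_iff.1 h.superset x)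

/-- The pair `(x, f)` is monotonically related to (the graph of) `A`. -/
def IsMonotonicallyRelated (A : X → Set (StrongDual ℝ X)) (x : X) (f : StrongDual ℝ X) : Prop :=
  ∀ y, ∀ g ∈ A y, 0 ≤ (g - f) (y - x)

theorem IsMonotone.isMonotonicallyRelated (hA : IsMonotone A) {x : X} {f : StrongDual ℝ X}
    (hf : f ∈ A x) : IsMonotonicallyRelated A x f :=
  fun y g hg => hA (y, g) hg (x, f) hf

theorem IsMonotone.mono (hB : IsMonotone B) (hAB : ∀ x, A x ⊆ B x) : IsMonotone A :=
  fun p hp q hq => hB p (hAB _ hp) q (hAB _ hq)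

theorem IsMonotone.add (hA : IsMonotone A) (hB : IsMonotone B) :
    IsMonotone fun x => A x + B x := by
  rintro ⟨x, _⟩ ⟨f, hf, g, hg, rfl⟩ ⟨y, _⟩ ⟨f', hf', g', hg', rfl⟩
  simpa [add_sub_add_comm] using
    add_nonneg (hA (x, f) hf (y, f') hf') (hB (x, g) hg (y, g') hg')

theorem isMonotone_subdifferential (θ : X → ℝ) : IsMonotone (subdifferential θ) := by
  rintro ⟨x, f⟩ hf ⟨y, g⟩ hg
  have hfy := hf y
  have hgx := hg x
  simp only [sub_apply, map_sub] at hfy hgx ⊢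
  linarith

theorem IsMonotone.union_of_isMonotonicallyRelated (hA : IsMonotone A) {x : X}
    {f : StrongDual ℝ X} (hf : IsMonotonicallyRelated A x f) :
    IsMonotone fun y => A y ∪ {g | y = x ∧ g = f} := by
  rintro ⟨y, g⟩ (hg | ⟨rfl, rfl⟩) ⟨z, h⟩ (hh | ⟨rfl, rfl⟩)
  · exact hA (y, g) hg (z, h) hh
  · exact hf y g hg
  · have hzh := hf z h hh
    simp only [sub_apply, map_sub] at hzh ⊢
    linarith
  · simp

theorem isMaximalMonotone_iff :
    IsMaximalMonotone A ↔
      IsMonotone A ∧ ∀ x f, IsMonotonicallyRelated A x f → f ∈ A x := by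
  refine and_congr_right fun hA => ⟨fun hmax x f hf => ?_, fun h S hS hAS => ?_⟩
  · have heq := hmax _ (hA.union_of_isMonotonicallyRelated hf)
      (gph_subset_gph_iff.2 fun _ => subset_union_left)
    exact heq.superset (show (x, f) ∈ gph _ from Or.inr ⟨rfl, rfl⟩)
  · exact hAS.antisymm <| gph_subset_gph_iff.2 fun x f hf => h x f fun y g hg =>
      hS.isMonotonicallyRelated hf y g (gph_subset_gph_iff.1 hAS y hg)

theorem IsMaximalMonotone.mem_of_isMonotonicallyRelated (hA : IsMaximalMonotone A) {x : X}
    {f : StrongDual ℝ X} (hf : IsMonotonicallyRelated A x f) : f ∈ A x :=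
  (isMaximalMonotone_iff.1 hA).2 x f hf

theorem IsMaximalMonotone.dom_nonempty (hA : IsMaximalMonotone A) : (dom A).Nonempty := by
  by_contra! hempty
  have hmem : (0 : StrongDual ℝ X) ∈ A 0 := hA.mem_of_isMonotonicallyRelated fun y g hg =>
    absurd (show y ∈ dom A from ⟨g, hg⟩) (hempty ▸ notMem_empty y)
  exact absurd (show (0 : X) ∈ dom A from ⟨0, hmem⟩) (hempty ▸ notMem_empty 0)

end MaximalMonotone

section Reflexive

variable {X : Type*} [NormedAddCommGroup X] [NormedSpace ℝ X] {A : X → Set (StrongDual ℝ X)}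

/-- The epigraph of the Fitzpatrick function `(x, f) ↦ sup {f y + g x - g y | g ∈ A y}` of `A`;
the epigraph is used because the function itself may take the value `+∞`. -/
def fitzpatrickEpigraph (A : X → Set (StrongDual ℝ X)) : Set ((X × StrongDual ℝ X) × ℝ) :=
  {q | ∀ y, ∀ g ∈ A y, q.1.2 y + g q.1.1 - g y ≤ q.2}

theorem convex_fitzpatrickEpigraph (A : X → Set (StrongDual ℝ X)) :
    Convex ℝ (fitzpatrickEpigraph A) := by
  rintro ⟨⟨x, f⟩, r⟩ hr ⟨⟨x', f'⟩, r'⟩ hr' a b ha hb hab y g hg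
  have h := mul_le_mul_of_nonneg_left (hr y g hg) ha
  have h' := mul_le_mul_of_nonneg_left (hr' y g hg) hb
  obtain rfl : b = 1 - a := by linarith
  simp only [Prod.smul_mk, Prod.mk_add_mk, add_apply, smul_apply, map_add, map_smul,
    smul_eq_mul] at h h' ⊢
  linarith

theorem IsMonotone.mem_fitzpatrickEpigraph (hA : IsMonotone A) {x : X} {f : StrongDual ℝ X}
    (hf : f ∈ A x) : ((x, f), f x) ∈ fitzpatrickEpigraph A := by
  intro y g hg
  have h := hA.isMonotonicallyRelated hf y g hg
  simp only [sub_apply, map_sub] at h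
  linarith

theorem IsMaximalMonotone.apply_le_of_mem_fitzpatrickEpigraph (hA : IsMaximalMonotone A) {x : X}
    {f : StrongDual ℝ X} {r : ℝ} (hr : ((x, f), r) ∈ fitzpatrickEpigraph A) : f x ≤ r := by
  by_contra! hlt
  have hf : f ∈ A x := hA.mem_of_isMonotonicallyRelated fun y g hg => by
    have h : f y + g x - g y ≤ r := hr y g hg
    simp only [sub_apply, map_sub]
    linarith
  have h : f x + f x - f x ≤ r := hr x f hf
  linarith

theorem Reflexive.exists_eq_apply_add_apply (hX : Reflexive X)
    (F : StrongDual ℝ (X × StrongDual ℝ X)) :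
    ∃ (k : StrongDual ℝ X) (z : X), ∀ x g, F (x, g) = k x + g z := by
  obtain ⟨z, hz⟩ := hX (F.comp (ContinuousLinearMap.inr ℝ X (StrongDual ℝ X)))
  refine ⟨F.comp (ContinuousLinearMap.inl ℝ X (StrongDual ℝ X)), z, fun x g => ?_⟩
  have hzg : g z = F (0, g) := DFunLike.congr_fun hz g
  simp [hzg, ← map_add]

theorem IsCofinite.concaveOn_sub_sub_conjugate {φ : X → ℝ} (hφ_cof : IsCofinite φ)
    (hφ : ConvexOn ℝ univ φ) (f : StrongDual ℝ X) :
    ConcaveOn ℝ univ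
      fun q : X × StrongDual ℝ X => f q.1 - φ q.1 - conjugate φ (f - q.2) := by
  have hf_fst : ConcaveOn ℝ univ fun q : X × StrongDual ℝ X => f q.1 :=
    (f.toLinearMap ∘ₗ LinearMap.fst ℝ X (StrongDual ℝ X)).concaveOn convex_univ
  have hφ_fst : ConvexOn ℝ univ fun q : X × StrongDual ℝ X => φ q.1 :=
    hφ.comp_linearMap (LinearMap.fst ℝ X (StrongDual ℝ X))
  have hconj_snd : ConvexOn ℝ univ fun q : X × StrongDual ℝ X => conjugate φ (f - q.2) :=
    hφ_cof.convexOn_conjugate.comp_affineMap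
      (AffineMap.const ℝ (X × StrongDual ℝ X) f - (LinearMap.snd ℝ X (StrongDual ℝ X)).toAffineMap)
  exact (hf_fst.sub hφ_fst).sub hconj_snd

/-- The affine function that separates the Fitzpatrick function of `A` from
`(x, g) ↦ f x - φ x - φ* (f - g)` has, by reflexivity, the linear part `(x, g) ↦ k x + g z`, and
then `k ∈ A z` and `f - k ∈ ∂φ z`. -/
theorem IsMaximalMonotone.exists_mem_add_subdifferential (hX : Reflexive X)
    (hA : IsMaximalMonotone A) {φ : X → ℝ} (hφ : ConvexOn ℝ univ φ) (hφ_cont : Continuous φ)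
    (hφ_cof : IsCofinite φ) (f : StrongDual ℝ X) : ∃ z, f ∈ A z + subdifferential φ z := by
  have hp_cont : Continuous
      fun q : X × StrongDual ℝ X => f q.1 - φ q.1 - conjugate φ (f - q.2) := by
    have := hφ_cof.continuous_conjugate
    fun_prop
  obtain ⟨y, g, hg⟩ := hA.dom_nonempty
  obtain ⟨F, c, hupp, hlow⟩ := exists_affine_between_concave_and_convex
    (hφ_cof.concaveOn_sub_sub_conjugate hφ f) hp_cont (convex_fitzpatrickEpigraph A)
    ⟨_, hA.1.mem_fitzpatrickEpigraph hg⟩ fun q hq => by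
      have hyoung := hφ_cof.apply_sub_le_conjugate (f - q.1.2) q.1.1
      rw [sub_apply] at hyoung
      linarith [hA.apply_le_of_mem_fitzpatrickEpigraph hq]
  obtain ⟨k, z, hF⟩ := hX.exists_eq_apply_add_apply F
  have hupp_z : ∀ x, f x - φ x - (f z - φ z) ≤ k x + c := by
    intro x
    obtain ⟨s, hs⟩ := subdifferential_nonempty hφ hφ_cont z
    have h := hupp (x, f - s)
    simp only [hF, sub_sub_cancel, sub_apply] at h
    linarith [conjugate_le_of_mem_subdifferential hs]
  have hlow_gph : ∀ x, ∀ g ∈ A x, k x + g z + c ≤ g x := by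
    intro x g hg
    simpa only [hF] using hlow _ (hA.1.mem_fitzpatrickEpigraph hg)
  have hkz : k ∈ A z := hA.mem_of_isMonotonicallyRelated fun x g hg => by
    simp only [sub_apply, map_sub]
    linarith [hlow_gph x g hg, hupp_z z]
  refine ⟨z, k, hkz, f - k, fun x => ?_, add_sub_cancel k f⟩
  simp only [sub_apply, map_sub]
  linarith [hupp_z x, hlow_gph z k hkz]

/-- The perturbed equation `f ∈ A z + ∂(θ + ‖· - x‖² / 2) z` has a solution `z`, and a pair `(x, f)`
monotonically related to `A + ∂θ` forces `z = x`. -/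
theorem IsMaximalMonotone.add_subdifferential_of_reflexive (hX : Reflexive X)
    (hA : IsMaximalMonotone A) {θ : X → ℝ} (hθ : ConvexOn ℝ univ θ) (hθ_cont : Continuous θ) :
    IsMaximalMonotone fun x => A x + subdifferential θ x := by
  refine isMaximalMonotone_iff.2
    ⟨hA.1.add (isMonotone_subdifferential θ), fun x f hf => ?_⟩
  have hquad : ConvexOn ℝ univ fun y => ‖y - x‖ ^ 2 / 2 := by
    simpa only [comp_def, sub_eq_add_neg, preimage_univ] using
      convexOn_half_sq_norm.translate_left (-x)
  obtain ⟨z, k, hk, d, hd, rfl⟩ := hA.exists_mem_add_subdifferential hX (hθ.add hquad)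
    (by fun_prop) (isCofinite_add_half_sq_dist hθ hθ_cont x) f
  obtain ⟨s, hs, i, hi, rfl⟩ :=
    exists_add_eq_of_mem_subdifferential_add hθ hquad (by fun_prop) hd
  rw [subdifferential_comp_sub_right (fun y => ‖y‖ ^ 2 / 2), subdifferential_half_sq_norm] at hi
  have hzx : z - x = 0 := by
    have h : 0 ≤ (k + s - (k + (s + i))) (z - x) := hf z (k + s) (add_mem_add hk hs)
    rw [← add_assoc, sub_add_cancel_left, neg_apply, hi.1] at h
    simpa using h.antisymm' (neg_nonpos.2 (sq_nonneg _))
  have hi_zero : i = 0 := by simpa [hzx] using hi.2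
  rw [hi_zero, add_zero, ← sub_eq_zero.1 hzx]
  exact add_mem_add hk hs

end Reflexive

section ConvexDomain

variable {X : Type*} [NormedAddCommGroup X] [NormedSpace ℝ X] {A B : X → Set (StrongDual ℝ X)}

theorem IsMaximalMonotone.add_smul_mem_of_forall_apply_le (hA : IsMaximalMonotone A) {y : X}
    {a n : StrongDual ℝ X} (ha : a ∈ A y) (hn : ∀ z ∈ dom A, n z ≤ n y) {s : ℝ} (hs : 0 ≤ s) :
    a + s • n ∈ A y :=
  hA.mem_of_isMonotonicallyRelated fun z b hb => by
    have hrel := hA.1.isMonotonicallyRelated ha z b hb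
    have hnormal := mul_le_mul_of_nonneg_left (hn z ⟨b, hb⟩) hs
    simp only [sub_apply, add_apply, smul_apply, map_sub, smul_eq_mul] at hrel ⊢
    linarith

theorem IsMaximalMonotone.mem_dom_of_isMonotonicallyRelated_add (hA : IsMaximalMonotone A)
    (hdom : IsComplete (dom A)) (hdom_conv : Convex ℝ (dom A)) (hB : ∀ y, (B y).Nonempty) {x : X}
    {f : StrongDual ℝ X} (hf : IsMonotonicallyRelated (fun y => A y + B y) x f) : x ∈ dom A := by
  by_contra hx
  obtain ⟨y, ⟨a, ha⟩, n, hn, hlt⟩ :=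
    exists_support_functional_lt hdom hdom_conv hA.dom_nonempty hx
  obtain ⟨b, hb⟩ := hB y
  have hray : ∀ s : ℝ, 0 ≤ s → s * (n x - n y) ≤ (a + b - f) (y - x) := by
    intro s hs
    have h := hf y _ (add_mem_add (hA.add_smul_mem_of_forall_apply_le ha hn hs) hb)
    simp only [sub_apply, add_apply, smul_apply, map_sub, smul_eq_mul] at h ⊢
    linarith
  obtain ⟨m, hm⟩ := exists_nat_gt ((a + b - f) (y - x) / (n x - n y))
  exact ((div_lt_iff₀ (sub_pos.2 hlt)).1 hm).not_ge (hray m m.cast_nonneg)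

theorem IsMonotone.le_sub_of_isMonotonicallyRelated_add_subdifferential (hA : IsMonotone A)
    {θ : X → ℝ} {x v : X} {f b : StrongDual ℝ X} {t : ℝ} (ht : 0 < t) (ht1 : t < 1)
    (hb : b ∈ A (x + v)) (hmem : x + t • v ∈ dom A)
    (hθ : (subdifferential θ (x + t • v)).Nonempty)
    (hf : IsMonotonicallyRelated (fun y => A y + subdifferential θ y) x f) :
    t * (f - b) v ≤ θ (x + t • (2 : ℝ) • v) - θ (x + t • v) := by
  obtain ⟨a, ha⟩ := hmem
  obtain ⟨s, hs⟩ := hθ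
  have hab : 0 ≤ (1 - t) * (b - a) v := by
    have h := hA.isMonotonicallyRelated ha (x + v) b hb
    rwa [show x + v - (x + t • v) = (1 - t) • v by module, map_smul, smul_eq_mul] at h
  have hrel : 0 ≤ t * (a + s - f) v := by
    simpa using hf _ _ (add_mem_add ha hs)
  have hsub := hs (x + t • (2 : ℝ) • v)
  rw [show x + t • (2 : ℝ) • v - (x + t • v) = t • v by module, map_smul, smul_eq_mul] at hsub
  have hab' : 0 ≤ t * (b - a) v :=
    mul_nonneg ht.le (nonneg_of_mul_nonneg_right hab (sub_pos.2 ht1))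
  simp only [sub_apply, add_apply] at hrel hab' ⊢
  linarith

/-- The points `x + t v` and `x + 2 t v` are compared because a subgradient at `x + t v` bounds
increments of `θ` from below only; in the limit, their difference quotient is again the derivative
of `θ` at `x`. -/
theorem IsMonotone.isMonotonicallyRelated_sub (hA : IsMonotone A) (hdom : Convex ℝ (dom A))
    {θ : X → ℝ} (hθ : ∀ y, (subdifferential θ y).Nonempty) {x : X} (hx : x ∈ dom A)
    (hθx : ∀ v, LineDifferentiableAt ℝ θ x v) {f s : StrongDual ℝ X}
    (hs : s ∈ subdifferential θ x)
    (hf : IsMonotonicallyRelated (fun y => A y + subdifferential θ y) x f) :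
    IsMonotonicallyRelated A x (f - s) := by
  intro y b hb
  obtain ⟨v, rfl⟩ : ∃ v, y = x + v := ⟨y - x, (add_sub_cancel x y).symm⟩
  have hderiv : HasLineDerivAt ℝ θ (s v) x v := hasLineDerivAt_of_mem_subdifferential hs (hθx v)
  have hslope : Tendsto (fun t : ℝ => t⁻¹ * (θ (x + t • (2 : ℝ) • v) - θ (x + t • v)))
      (𝓝[>] 0) (𝓝 (s v)) := by
    have h := (hderiv.smul 2).tendsto_slope_zero_right.sub hderiv.tendsto_slope_zero_right
    simpa [two_mul, ← mul_sub] using h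
  have hlim : (f - b) v ≤ s v := by
    refine ge_of_tendsto hslope ?_
    filter_upwards [Ioo_mem_nhdsGT (zero_lt_one (α := ℝ))] with t ⟨ht, ht1⟩
    have hmem : x + t • v ∈ dom A := hdom.add_smul_mem hx ⟨b, hb⟩ ⟨ht.le, ht1.le⟩
    rw [le_inv_mul_iff₀ ht]
    exact hA.le_sub_of_isMonotonicallyRelated_add_subdifferential ht ht1 hb hmem (hθ _) hf
  simp only [sub_apply, add_sub_cancel_left] at hlim ⊢
  linarith

theorem IsMaximalMonotone.add_subdifferential_of_convex_dom (hA : IsMaximalMonotone A)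
    (hdom : IsComplete (dom A)) (hdom_conv : Convex ℝ (dom A)) {θ : X → ℝ}
    (hθ : ∀ y, (subdifferential θ y).Nonempty) (hθ_diff : ∀ y v, LineDifferentiableAt ℝ θ y v) :
    IsMaximalMonotone fun x => A x + subdifferential θ x := by
  refine isMaximalMonotone_iff.2
    ⟨hA.1.add (isMonotone_subdifferential θ), fun x f hf => ?_⟩
  have hx : x ∈ dom A := hA.mem_dom_of_isMonotonicallyRelated_add hdom hdom_conv hθ hf
  obtain ⟨s, hs⟩ := hθ x
  have hmem : f - s ∈ A x := hA.mem_of_isMonotonicallyRelated <|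
    hA.1.isMonotonicallyRelated_sub hdom_conv hθ hx (hθ_diff x) hs hf
  exact ⟨f - s, hmem, s, hs, sub_add_cancel f s⟩

end ConvexDomain

section StronglyMonotone

variable {X : Type*} [NormedAddCommGroup X] [NormedSpace ℝ X]

theorem GateauxSmooth.sub_add_smul_dualityMap (hX : GateauxSmooth X) (σ : ℝ)
    (T : X → Set (StrongDual ℝ X)) (x : X) :
    T x - σ • dualityMap x + σ • dualityMap x = T x := by
  obtain ⟨j, hj⟩ := hX.exists_dualityMap_eq_singleton x
  simp only [hj, smul_set_singleton, sub_singleton, add_singleton, image_image, sub_add_cancel,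
    image_id']

theorem GateauxSmooth.add_sub_smul_dualityMap (hX : GateauxSmooth X) (σ : ℝ)
    (T : X → Set (StrongDual ℝ X)) (x : X) :
    T x + σ • dualityMap x - σ • dualityMap x = T x := by
  obtain ⟨j, hj⟩ := hX.exists_dualityMap_eq_singleton x
  simp only [hj, smul_set_singleton, sub_singleton, add_singleton, image_image,
    add_sub_cancel_right, image_id']

theorem dom_sub_smul_dualityMap (σ : ℝ) (T : X → Set (StrongDual ℝ X)) :
    dom (fun x => T x - σ • dualityMap x) = dom T :=
  ext fun x => ⟨Set.Nonempty.of_sub_left, fun h => h.sub (dualityMap_nonempty x).smul_set⟩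

theorem isMonotone_smul_dualityMap {σ : ℝ} (hσ : 0 < σ) :
    IsMonotone fun x : X => σ • dualityMap x := by
  simp only [← subdifferential_mul_half_sq_norm hσ]
  exact isMonotone_subdifferential _

theorem IsStronglyMonotone.isMonotone {σ : ℝ} (hσ : 0 < σ) {T : X → Set (StrongDual ℝ X)}
    (hT : IsStronglyMonotone σ T) : IsMonotone T := by
  refine (IsMonotone.add hT (isMonotone_smul_dualityMap hσ)).mono fun x f hf => ?_
  obtain ⟨j, hj⟩ := (dualityMap_nonempty x).smul_set (a := σ)
  exact ⟨f - j, sub_mem_sub hf hj, j, hj, sub_add_cancel f j⟩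

theorem IsStronglyMonotone.isMaximalMonotone_sub (hX : GateauxSmooth X) {σ : ℝ}
    {T : X → Set (StrongDual ℝ X)} (hT : IsStronglyMonotone σ T)
    (hmax : ∀ S : X → Set (StrongDual ℝ X), IsStronglyMonotone σ S → gph T ⊆ gph S →
      gph T = gph S) :
    IsMaximalMonotone fun x => T x - σ • dualityMap x := by
  refine ⟨hT, fun S hS hTS => ?_⟩
  rw [gph_subset_gph_iff] at hTS
  have hS_strong : IsStronglyMonotone σ fun x => S x + σ • dualityMap x := by
    simpa only [IsStronglyMonotone, hX.add_sub_smul_dualityMap] using hS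
  have hT_eq : T = fun x => S x + σ • dualityMap x :=
    gph_injective <| hmax _ hS_strong <| gph_subset_gph_iff.2 fun x =>
      (hX.sub_add_smul_dualityMap σ T x).symm.trans_subset (add_subset_add_right (hTS x))
  simp only [hT_eq, hX.add_sub_smul_dualityMap]

theorem GateauxSmooth.isMaximalMonotone_add_smul_dualityMap (hX : GateauxSmooth X) {σ : ℝ}
    (hσ : 0 < σ) {A : X → Set (StrongDual ℝ X)} (hA : IsMaximalMonotone A)
    (h : Reflexive X ∨ (IsComplete (dom A) ∧ Convex ℝ (dom A))) :
    IsMaximalMonotone fun x => A x + σ • dualityMap x := by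
  have hconv : ConvexOn ℝ univ fun x : X => σ * (‖x‖ ^ 2 / 2) :=
    convexOn_half_sq_norm.smul hσ.le
  have hcont : Continuous fun x : X => σ * (‖x‖ ^ 2 / 2) := by fun_prop
  simp only [← subdifferential_mul_half_sq_norm hσ]
  rcases h with hrefl | ⟨hdom, hdom_conv⟩
  · exact hA.add_subdifferential_of_reflexive hrefl hconv hcont
  · exact hA.add_subdifferential_of_convex_dom hdom hdom_conv
      (subdifferential_nonempty hconv hcont)
      fun x v => (hX.lineDifferentiableAt_half_sq_norm x v).const_mul σ

theorem mainTheorem7_general (hX : GateauxSmooth X) (σ : ℝ) (hσ : 0 < σ)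
    (T : X → Set (StrongDual ℝ X)) (hT : IsStronglyMonotone σ T)
    (h : Reflexive X ∨ (IsComplete (dom T) ∧ Convex ℝ (dom T))) :
    IsStronglyMaximalMonotone σ T ↔
      ∀ S : X → Set (StrongDual ℝ X), IsStronglyMonotone σ S → gph T ⊆ gph S →
        gph T = gph S := by
  refine ⟨fun hmax S hS => hmax.2.2 S (hS.isMonotone hσ), fun hmax => ⟨hT, ?_⟩⟩
  have hsub : IsMaximalMonotone fun x => T x - σ • dualityMap x :=
    hT.isMaximalMonotone_sub hX hmax
  rw [← dom_sub_smul_dualityMap σ T] at h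
  simpa only [hX.sub_add_smul_dualityMap] using
    hX.isMaximalMonotone_add_smul_dualityMap hσ hsub h

end StronglyMonotone

end MonotoneOperators

theorem mainTheorem7 {X : Type*} [NormedAddCommGroup X] [NormedSpace ℝ X] [CompleteSpace X]
    (hX : MonotoneOperators.GateauxSmooth X)
    (σ : ℝ) (hσ : 0 < σ)
    (T : X → Set (StrongDual ℝ X))
    (hT : MonotoneOperators.IsStronglyMonotone σ T)
    (h : MonotoneOperators.Reflexive X ∨
      (IsClosed (MonotoneOperators.dom T) ∧ Convex ℝ (MonotoneOperators.dom T))) :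
    MonotoneOperators.IsStronglyMaximalMonotone σ T ↔
      ∀ S : X → Set (StrongDual ℝ X), MonotoneOperators.IsStronglyMonotone σ S →
        MonotoneOperators.gph T ⊆ MonotoneOperators.gph S →
          MonotoneOperators.gph T = MonotoneOperators.gph S :=
  MonotoneOperators.mainTheorem7_general hX σ hσ T hT
    (h.imp_right fun ⟨hclosed, hconvex⟩ => ⟨hclosed.isComplete, hconvex⟩)
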